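/- Let $n\ge 2$, $0<\sigma<1$, $\rho>0$, and let $S\subset\mathbb{R}^n$ be the sphere of radius $\rho$ with center $c$, oriented by its outward unit normal $\mathbf n(z)=(z-c)/\rho$. For $z\in S$ let $T_zS=\mathbf n(z)^{\perp}$ be the tangent space. Let $\mathcal X(S)$ be the set of pairs $(x,y)\in\mathbb{R}^n\times\mathbb{R}^n$ such that the segment joining $x$ and $y$ crosses $S$ an odd number of times (only points of $S$ strictly between $x$ and $y$ are counted). Put $\widehat\chi_S(z,y)=1$ if either $(z,y)\notin\mathcal X(S)$ and $(z-y)\cdot\mathbf n(z)>0$, or $(z,y)\in\mathcal X(S)$ and $(z-y)\cdot\mathbf n(z)<0$; put $\widehat\chi_S(z,y)=-1$ if either $(z,y)\in\mathcal X(S)$ and $(z-y)\cdot\mathbf n(z)>0$, or $(z,y)\notin\mathcal X(S)$ and $(z-y)\cdot\mathbf n(z)<0$; and $\widehat\chi_S(z,y)=0$ otherwise. For a unit vector $e\in T_zS$ let $\pi(z,e)=\{z+te+h\,\mathbf n(z): t>0,\ h\in\mathbb{R}\}$, and for $y\in\pi(z,e)$ let $y'$ be the orthogonal projection of $y$ onto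 the line through $z$ in the direction $e$. The nonlocal directional curvature at $z$ in the direction $e$ is the principal value $$k_{\sigma,e}(z)=\lim_{\varepsilon\to0^+}\int_{\pi(z,e)\setminus B_\varepsilon(z)}\frac{|z-y'|^{n-2}\,\widehat\chi_S(z,y)}{|z-y|^{n+\sigma}}\,dy ,$$ where $dy$ is the area measure of the half-plane, and the nonlocal curvature tensor is the linear operator on $T_zS$ $$L_\sigma(z)=\frac{n-1}{(1+\sigma)\,\omega_{n-2}}\int_{\{e\in T_zS:\,|e|=1\}}k_{\sigma,e}(z)\big((n+\sigma)\,e\otimes e-\mathbf 1_{T_zS}\big)\,de ,$$ where $de$ is the surface measure on the unit sphere of $T_zS$ (counting measure if $n=2$) and $\omega_{n-2}$ is the measure of the unit sphere in $\mathbb{R}^{n-1}$. Then, for every $z\in S$ and every unit vector $e\in T_zS$, the integrals over $\pi(z,e)\setminus B_\varepsilon(z)$ converge absolutely for all $\varepsilon>0$, the limit exists, and $$k_{\sigma,e}(z)=-\frac{B\!\left(\tfrac{1-\sigma}{2},\tfrac{n-1}{2}\right)}{\sigma\,(2\rho)^{\sigma}} ,$$ where $B$ is the Euler beta function. Consequently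 the integral defining $L_\sigma(z)$ converges absolutely and $$L_\sigma(z)=-\frac{B\!\left(\tfrac{1-\sigma}{2},\tfrac{n-1}{2}\right)}{\sigma\,(2\rho)^{\sigma}}\;\mathbf 1_{T_zS}.$$ -/

import Mathlib

open MeasureTheory Metric Filter Topology Set
open scoped RealInnerProductSpace

noncomputable section

namespace NonlocalCurvature

section Sphere

variable (F : Type*) [NormedAddCommGroup F] [InnerProductSpace ℝ F]
  [FiniteDimensional ℝ F] [MeasurableSpace F] [BorelSpace F]

/-- The standard surface measure on the unit sphere of a finite-dimensional Euclidean space `F`,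
induced by the Lebesgue measure of `F`. In dimension one it is the counting measure on the two
unit vectors. -/
def unitSphereMeasure : Measure (sphere (0 : F) 1) :=
  (volume : Measure F).toSphere

/-- The operator `k(e) (a e ⊗ e - 1)` on `F`, for a unit vector `e`. -/
def sphereIntegrand (a : ℝ) (k : sphere (0 : F) 1 → ℝ) (e : sphere (0 : F) 1) : F →L[ℝ] F :=
  k e • (a • InnerProductSpace.rankOne ℝ (e : F) (e : F) - ContinuousLinearMap.id ℝ F)

/-- The integral of `k(e) (a e ⊗ e - 1)` over the unit vectors `e` converges absolutely. -/
def SphereIntegrable (a : ℝ) (k : sphere (0 : F) 1 → ℝ) : Prop :=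
  Integrable (sphereIntegrand F a k) (unitSphereMeasure F)

/-- The integral of `k(e) (a e ⊗ e - 1)` over the unit vectors `e` of `F`. -/
def sphereIntegral (a : ℝ) (k : sphere (0 : F) 1 → ℝ) : F →L[ℝ] F :=
  ∫ e, sphereIntegrand F a k e ∂(unitSphereMeasure F)

end Sphere

/-- `omega d` is the `(d - 1)`-dimensional measure of the unit sphere of `ℝ^d`. -/
def omega (d : ℕ) : ℝ :=
  (unitSphereMeasure (EuclideanSpace ℝ (Fin d))).real univ

variable {n : ℕ}

/-- The pairs `(x, y)` such that the segment from `x` to `y` crosses `S` an odd number of times.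
End points are not crossings: only points strictly between `x` and `y` are counted. -/
def oddCrossing (S : Set (EuclideanSpace ℝ (Fin n))) :
    Set (EuclideanSpace ℝ (Fin n) × EuclideanSpace ℝ (Fin n)) :=
  {p | (openSegment ℝ p.1 p.2 ∩ S).Finite ∧ Odd (openSegment ℝ p.1 p.2 ∩ S).ncard}

/-- The set `𝒜_e(z)` of an oriented hypersurface `S` with unit normal field `ν`. -/
def exteriorSet (S : Set (EuclideanSpace ℝ (Fin n)))
    (ν : EuclideanSpace ℝ (Fin n) → EuclideanSpace ℝ (Fin n)) (z : EuclideanSpace ℝ (Fin n)) :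
    Set (EuclideanSpace ℝ (Fin n)) :=
  {y | ((z, y) ∈ oddCrossing S ∧ 0 < ⟪z - y, ν z⟫) ∨
    ((z, y) ∉ oddCrossing S ∧ ⟪z - y, ν z⟫ < 0)}

/-- The set `𝒜_i(z)` of an oriented hypersurface `S` with unit normal field `ν`. -/
def interiorSet (S : Set (EuclideanSpace ℝ (Fin n)))
    (ν : EuclideanSpace ℝ (Fin n) → EuclideanSpace ℝ (Fin n)) (z : EuclideanSpace ℝ (Fin n)) :
    Set (EuclideanSpace ℝ (Fin n)) :=
  {y | ((z, y) ∉ oddCrossing S ∧ 0 < ⟪z - y, ν z⟫) ∨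
    ((z, y) ∈ oddCrossing S ∧ ⟪z - y, ν z⟫ < 0)}

open Classical in
/-- The function `χ̂_S(z, y)`: `1` on `𝒜_i(z)`, `-1` on `𝒜_e(z)`, and `0` elsewhere. -/
def chiHat (S : Set (EuclideanSpace ℝ (Fin n)))
    (ν : EuclideanSpace ℝ (Fin n) → EuclideanSpace ℝ (Fin n)) (z y : EuclideanSpace ℝ (Fin n)) :
    ℝ :=
  if y ∈ interiorSet S ν z then 1 else if y ∈ exteriorSet S ν z then -1 else 0

/-- The tangent space at `z` of a hypersurface with unit normal field `ν`. -/
abbrev tangentSpace (ν : EuclideanSpace ℝ (Fin n) → EuclideanSpace ℝ (Fin n))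
    (z : EuclideanSpace ℝ (Fin n)) : Submodule ℝ (EuclideanSpace ℝ (Fin n)) :=
  (Submodule.span ℝ {ν z})ᗮ

/-- The open half-plane `π(z, e)` bounded by the normal line at `z`, in the direction `e`. -/
def halfPlane (ν : EuclideanSpace ℝ (Fin n) → EuclideanSpace ℝ (Fin n))
    (z e : EuclideanSpace ℝ (Fin n)) : Set (EuclideanSpace ℝ (Fin n)) :=
  {y | ∃ t h : ℝ, 0 < t ∧ y = z + t • e + h • ν z}

/-- The orthogonal projection `y'` of `y` onto the line through `z` in the direction `e`. -/
def lineProj (z e y : EuclideanSpace ℝ (Fin n)) : EuclideanSpace ℝ (Fin n) :=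
  z + (Submodule.span ℝ {e}).starProjection (y - z)

/-- The integrand `|z - y'|^(n-2) χ̂_S(z, y) / |z - y|^(n+σ)` of the directional curvature. -/
def directionalIntegrand (S : Set (EuclideanSpace ℝ (Fin n)))
    (ν : EuclideanSpace ℝ (Fin n) → EuclideanSpace ℝ (Fin n)) (σ : ℝ)
    (z e y : EuclideanSpace ℝ (Fin n)) : ℝ :=
  ‖z - lineProj z e y‖ ^ ((n : ℝ) - 2) * chiHat S ν z y / ‖z - y‖ ^ ((n : ℝ) + σ)

/-- The integral over `π(z, e) \ B_ε(z)`, with respect to the area measure of the half-plane. -/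
def truncatedDirectionalCurvature (S : Set (EuclideanSpace ℝ (Fin n)))
    (ν : EuclideanSpace ℝ (Fin n) → EuclideanSpace ℝ (Fin n)) (σ : ℝ)
    (z e : EuclideanSpace ℝ (Fin n)) (ε : ℝ) : ℝ :=
  ∫ y in halfPlane ν z e \ ball z ε, directionalIntegrand S ν σ z e y
    ∂(Measure.euclideanHausdorffMeasure 2)

/-- The principal value defining the nonlocal directional curvature exists and equals `k`. -/
def HasNonlocalDirectionalCurvature (S : Set (EuclideanSpace ℝ (Fin n)))
    (ν : EuclideanSpace ℝ (Fin n) → EuclideanSpace ℝ (Fin n)) (σ : ℝ)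
    (z e : EuclideanSpace ℝ (Fin n)) (k : ℝ) : Prop :=
  (∀ ε : ℝ, 0 < ε → IntegrableOn (directionalIntegrand S ν σ z e) (halfPlane ν z e \ ball z ε)
    (Measure.euclideanHausdorffMeasure 2)) ∧
  Tendsto (truncatedDirectionalCurvature S ν σ z e) (𝓝[>] 0) (𝓝 k)

/-- The nonlocal directional curvature `k_{σ,e}(z)`, the principal value of the integral over
`π(z, e)`. -/
def nonlocalDirectionalCurvature (S : Set (EuclideanSpace ℝ (Fin n)))
    (ν : EuclideanSpace ℝ (Fin n) → EuclideanSpace ℝ (Fin n)) (σ : ℝ)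
    (z e : EuclideanSpace ℝ (Fin n)) : ℝ :=
  limUnder (𝓝[>] 0) (truncatedDirectionalCurvature S ν σ z e)

/-- The nonlocal directional curvature as a function of the unit tangent vector. -/
def tangentialCurvature (S : Set (EuclideanSpace ℝ (Fin n)))
    (ν : EuclideanSpace ℝ (Fin n) → EuclideanSpace ℝ (Fin n)) (σ : ℝ)
    (z : EuclideanSpace ℝ (Fin n)) (e : sphere (0 : tangentSpace ν z) 1) : ℝ :=
  nonlocalDirectionalCurvature S ν σ z ((e : tangentSpace ν z) : EuclideanSpace ℝ (Fin n))

/-- The integrand `k_{σ,e}(z) ((n + σ) e ⊗ e - 1)` of the nonlocal curvature tensor converges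
absolutely over the unit tangent vectors `e`. -/
def TensorIntegrable (S : Set (EuclideanSpace ℝ (Fin n)))
    (ν : EuclideanSpace ℝ (Fin n) → EuclideanSpace ℝ (Fin n)) (σ : ℝ)
    (z : EuclideanSpace ℝ (Fin n)) : Prop :=
  SphereIntegrable (tangentSpace ν z) ((n : ℝ) + σ) (tangentialCurvature S ν σ z)

/-- The nonlocal curvature tensor `L_σ(z)`, a linear operator on the tangent space at `z`:
`(n - 1) / ((1 + σ) ω_{n-2}) * ∫ k_{σ,e}(z) ((n + σ) e ⊗ e - 1) de` over the unit tangent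
vectors `e`. -/
def nonlocalCurvatureTensor (S : Set (EuclideanSpace ℝ (Fin n)))
    (ν : EuclideanSpace ℝ (Fin n) → EuclideanSpace ℝ (Fin n)) (σ : ℝ)
    (z : EuclideanSpace ℝ (Fin n)) : tangentSpace ν z →L[ℝ] tangentSpace ν z :=
  (((n : ℝ) - 1) / ((1 + σ) * omega (n - 1))) •
    sphereIntegral (tangentSpace ν z) ((n : ℝ) + σ) (tangentialCurvature S ν σ z)

/-- The outward unit normal field of the sphere of center `c` and radius `ρ`. -/
def sphereNormal (c : EuclideanSpace ℝ (Fin n)) (ρ : ℝ) (z : EuclideanSpace ℝ (Fin n)) :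
    EuclideanSpace ℝ (Fin n) :=
  ρ⁻¹ • (z - c)

end NonlocalCurvature

end

namespace NonlocalCurvature

section Plane

variable {E : Type*} [NormedAddCommGroup E] [InnerProductSpace ℝ E]

/-- The parametrization `t + i h ↦ z + t e + h u` of the plane through `z` spanned by `e`, `u`. -/
def planeMap (z e u : E) (w : ℂ) : E := z + w.re • e + w.im • u

theorem planeMap_sub (z e u : E) (w : ℂ) : planeMap z e u w - z = w.re • e + w.im • u := by
  simp only [planeMap]; abel

theorem norm_re_smul_add_im_smul {e u : E} (he : ‖e‖ = 1) (hu : ‖u‖ = 1) (heu : ⟪e, u⟫ = 0)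
    (w : ℂ) : ‖w.re • e + w.im • u‖ = ‖w‖ := by
  have h : ‖w.re • e + w.im • u‖ ^ 2 = ‖w‖ ^ 2 := by
    rw [norm_add_sq_real, real_inner_smul_left, real_inner_smul_right, heu, norm_smul, norm_smul,
      he, hu, Complex.sq_norm, Complex.normSq_apply]
    simp only [mul_one, Real.norm_eq_abs, sq_abs]
    ring
  exact (sq_eq_sq₀ (norm_nonneg _) (norm_nonneg _)).1 h

theorem isometry_planeMap (z : E) {e u : E} (he : ‖e‖ = 1) (hu : ‖u‖ = 1) (heu : ⟪e, u⟫ = 0) :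
    Isometry (planeMap z e u) := by
  refine Isometry.of_dist_eq fun v w => ?_
  rw [dist_eq_norm, dist_eq_norm, ← norm_re_smul_add_im_smul he hu heu (v - w)]
  congr 1
  simp only [planeMap, Complex.sub_re, Complex.sub_im]
  module

theorem map_planeMap [MeasurableSpace E] [BorelSpace E] (z : E) {e u : E} (he : ‖e‖ = 1)
    (hu : ‖u‖ = 1) (heu : ⟪e, u⟫ = 0) :
    (volume : Measure ℂ).map (planeMap z e u) =
      (Measure.euclideanHausdorffMeasure 2).restrict (range (planeMap z e u)) := by
  rw [← (isometry_planeMap z he hu heu).map_euclideanHausdorffMeasure,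
    ← InnerProductSpace.euclideanHausdorffMeasure_eq_volume, Complex.finrank_real_complex]

end Plane

section Crossing

variable {n : ℕ}

theorem add_smul_mem_sphere_iff {c z v : EuclideanSpace ℝ (Fin n)} {ρ : ℝ} (hz : z ∈ sphere c ρ)
    {s : ℝ} (hs : s ≠ 0) : z + s • v ∈ sphere c ρ ↔ s * ‖v‖ ^ 2 = -2 * ⟪z - c, v⟫ := by
  have hρ : ‖z - c‖ = ρ := by simpa [dist_eq_norm] using hz
  have hρ0 : 0 ≤ ρ := hρ ▸ norm_nonneg _
  have key : ‖z + s • v - c‖ ^ 2 = ρ ^ 2 + s * (2 * ⟪z - c, v⟫ + s * ‖v‖ ^ 2) := by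
    rw [show z + s • v - c = (z - c) + s • v by abel, norm_add_sq_real, real_inner_smul_right,
      norm_smul, hρ, mul_pow, Real.norm_eq_abs, sq_abs]
    ring
  rw [mem_sphere, dist_eq_norm, ← sq_eq_sq₀ (norm_nonneg _) hρ0, key]
  constructor
  · intro h
    have : s * (2 * ⟪z - c, v⟫ + s * ‖v‖ ^ 2) = 0 := by linarith
    rcases mul_eq_zero.1 this with h | h
    · exact absurd h hs
    · linarith
  · intro h
    rw [h]; ring

theorem mem_oddCrossing_sphere_iff {c z v : EuclideanSpace ℝ (Fin n)} {ρ : ℝ}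
    (hz : z ∈ sphere c ρ) (hv : v ≠ 0) :
    (z, z + v) ∈ oddCrossing (sphere c ρ) ↔ ⟪z - c, v⟫ < 0 ∧ 0 < ‖v‖ ^ 2 + 2 * ⟪z - c, v⟫ := by
  have hv2 : 0 < ‖v‖ ^ 2 := by positivity
  have hseg : openSegment ℝ z (z + v) = (fun s : ℝ => z + s • v) '' Ioo 0 1 := by
    rw [openSegment_eq_image']; simp
  set a := ⟪z - c, v⟫ with ha
  by_cases h : a < 0 ∧ 0 < ‖v‖ ^ 2 + 2 * a
  · have hset : openSegment ℝ z (z + v) ∩ sphere c ρ = {z + (-2 * a / ‖v‖ ^ 2) • v} := by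
      rw [hseg]
      ext x
      simp only [mem_inter_iff, mem_image, mem_singleton_iff]
      constructor
      · rintro ⟨⟨s, hs, rfl⟩, hx⟩
        rw [add_smul_mem_sphere_iff hz hs.1.ne'] at hx
        rw [← hx, mul_div_cancel_right₀ _ hv2.ne']
      · rintro rfl
        have h0 : 0 < -2 * a / ‖v‖ ^ 2 := div_pos (by linarith) hv2
        refine ⟨⟨_, ⟨h0, (div_lt_one hv2).2 (by linarith)⟩, rfl⟩, ?_⟩
        rw [add_smul_mem_sphere_iff hz h0.ne', div_mul_cancel₀ _ hv2.ne']
    simp only [oddCrossing, mem_ofPred_eq, hset, h]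
    simp
  · have hset : openSegment ℝ z (z + v) ∩ sphere c ρ = ∅ := by
      rw [hseg, eq_empty_iff_forall_notMem]
      rintro x ⟨⟨s, hs, rfl⟩, hx⟩
      simp only at hx
      rw [add_smul_mem_sphere_iff hz hs.1.ne', ← ha] at hx
      apply h
      constructor
      · nlinarith [mul_pos hs.1 hv2]
      · nlinarith [mul_pos (sub_pos.2 hs.2) hv2]
    simp only [oddCrossing, mem_ofPred_eq, hset, h]
    simp

theorem chiHat_sphere_add {c z v : EuclideanSpace ℝ (Fin n)} {ρ : ℝ} (hρ : 0 < ρ)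
    (hz : z ∈ sphere c ρ) (hv : v ≠ 0) :
    chiHat (sphere c ρ) (sphereNormal c ρ) z (z + v) =
      if ⟪z - c, v⟫ < 0 ∧ ‖v‖ ^ 2 + 2 * ⟪z - c, v⟫ ≤ 0 then 1
      else if ⟪z - c, v⟫ = 0 then 0 else -1 := by
  have hin : ⟪z - (z + v), sphereNormal c ρ z⟫ = -(ρ⁻¹ * ⟪z - c, v⟫) := by
    rw [sphereNormal, real_inner_smul_right, sub_add_cancel_left, inner_neg_left,
      real_inner_comm]
    ring
  have hρ' : 0 < ρ⁻¹ := inv_pos.2 hρ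
  have h1 : 0 < -(ρ⁻¹ * ⟪z - c, v⟫) ↔ ⟪z - c, v⟫ < 0 := by
    rw [neg_pos, mul_neg_iff]; simp [hρ', hρ'.not_gt]
  have h2 : -(ρ⁻¹ * ⟪z - c, v⟫) < 0 ↔ 0 < ⟪z - c, v⟫ := by
    rw [neg_lt_zero, mul_pos_iff]; simp [hρ', hρ'.not_gt]
  simp only [chiHat, interiorSet, exteriorSet, mem_ofPred_eq, hin, h1, h2,
    mem_oddCrossing_sphere_iff hz hv]
  grind

end Crossing

section Beta

open ProbabilityTheory Real

theorem integrableOn_rpow_mul_one_sub_rpow {a b : ℝ} (ha : 0 < a) (hb : 0 < b) :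
    IntegrableOn (fun x : ℝ => x ^ (a - 1) * (1 - x) ^ (b - 1)) (Ioo 0 1) := by
  have h : Integrable (betaPDFReal a b) := by
    refine ⟨(measurable_betaPDFReal a b).aestronglyMeasurable, ?_⟩
    rw [hasFiniteIntegral_iff_ofReal]
    · exact (lintegral_betaPDF_eq_one ha hb).trans_lt ENNReal.one_lt_top
    · refine ae_of_all _ fun x => ?_
      by_cases hx : 0 < x ∧ x < 1
      · exact (betaPDFReal_pos hx.1 hx.2 ha hb).le
      · simp [betaPDFReal, hx]
  refine IntegrableOn.congr_fun ((h.integrableOn (s := Ioo 0 1)).const_mul (beta a b)) ?_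
    measurableSet_Ioo
  intro x hx
  have := (beta_pos ha hb).ne'
  simp only [betaPDFReal, if_pos (show 0 < x ∧ x < 1 from hx)]
  field_simp

theorem integral_rpow_mul_one_sub_rpow {a b : ℝ} (ha : 0 < a) (hb : 0 < b) :
    ∫ x in Ioo (0 : ℝ) 1, x ^ (a - 1) * (1 - x) ^ (b - 1) = beta a b := by
  have h1 := lintegral_betaPDF_eq_one ha hb
  rw [lintegral_betaPDF] at h1
  simp_rw [mul_assoc] at h1
  rw [← ofReal_integral_eq_lintegral_ofReal
    ((integrableOn_rpow_mul_one_sub_rpow ha hb).const_mul _), integral_const_mul,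
    ENNReal.ofReal_eq_one] at h1
  · have := (beta_pos ha hb).ne'
    field_simp at h1
    exact h1
  · filter_upwards [ae_restrict_mem measurableSet_Ioo] with x hx
    have := beta_pos ha hb
    have h1 : 0 < x := hx.1
    have h2 : 0 < 1 - x := sub_pos.2 hx.2
    simp only [Pi.zero_apply]
    positivity

theorem image_sin_sq_Ioo : (fun θ : ℝ => sin θ ^ 2) '' Ioo 0 (π / 2) = Ioo 0 1 := by
  ext x
  constructor
  · rintro ⟨θ, hθ, rfl⟩
    have hs : 0 < sin θ := sin_pos_of_pos_of_lt_pi hθ.1 (by linarith [hθ.2, pi_pos])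
    have hc : 0 < cos θ := cos_pos_of_mem_Ioo ⟨by linarith [hθ.1, pi_pos], hθ.2⟩
    have := sin_sq_add_cos_sq θ
    exact ⟨by positivity, by simp only; nlinarith⟩
  · intro hx
    have h0 : 0 < √x := sqrt_pos.2 hx.1
    have h1 : √x < 1 := by rw [sqrt_lt' one_pos]; simpa using hx.2
    refine ⟨arcsin √x, ⟨arcsin_pos.2 h0, arcsin_lt_pi_div_two.2 h1⟩, ?_⟩
    simp only
    rw [sin_arcsin (by linarith) h1.le, sq_sqrt hx.1.le]

theorem injOn_sin_sq : InjOn (fun θ : ℝ => sin θ ^ 2) (Ioo 0 (π / 2)) := by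
  intro x hx y hy h
  have hs : ∀ θ ∈ Ioo (0 : ℝ) (π / 2), 0 ≤ sin θ := fun θ hθ =>
    (sin_pos_of_pos_of_lt_pi hθ.1 (by linarith [hθ.2, pi_pos])).le
  have := (sq_eq_sq₀ (hs x hx) (hs y hy)).1 h
  exact injOn_sin ⟨by linarith [hx.1, pi_pos], hx.2.le⟩ ⟨by linarith [hy.1, pi_pos], hy.2.le⟩ this

theorem hasDerivAt_sin_sq (θ : ℝ) :
    HasDerivAt (fun θ : ℝ => sin θ ^ 2) (2 * sin θ * cos θ) θ := by
  convert! (hasDerivAt_sin θ).pow 2 using 1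
  simp

theorem abs_deriv_sin_sq_smul {σ p θ : ℝ} (hθ : θ ∈ Ioo 0 (π / 2)) :
    |2 * sin θ * cos θ| • ((sin θ ^ 2) ^ ((1 - σ) / 2 - 1) * (1 - sin θ ^ 2) ^ ((p + 1) / 2 - 1)) =
      2 * (cos θ ^ p * sin θ ^ (-σ)) := by
  have hs : 0 < sin θ := sin_pos_of_pos_of_lt_pi hθ.1 (by linarith [hθ.2, pi_pos])
  have hc : 0 < cos θ := cos_pos_of_mem_Ioo ⟨by linarith [hθ.1, pi_pos], hθ.2⟩
  rw [abs_of_pos (by positivity), ← cos_sq', smul_eq_mul, ← rpow_natCast (sin θ),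
    ← rpow_natCast (cos θ), ← rpow_mul hs.le, ← rpow_mul hc.le,
    show p = 1 + (2 : ℕ) * ((p + 1) / 2 - 1) by push_cast; ring,
    show -σ = 1 + (2 : ℕ) * ((1 - σ) / 2 - 1) by push_cast; ring,
    rpow_add hs, rpow_add hc, rpow_one, rpow_one]
  ring_nf

theorem integrableOn_cos_rpow_mul_sin_rpow {σ p : ℝ} (hσ : σ < 1) (hp : -1 < p) :
    IntegrableOn (fun θ => cos θ ^ p * sin θ ^ (-σ)) (Ioo 0 (π / 2)) := by
  have h := integrableOn_rpow_mul_one_sub_rpow (a := (1 - σ) / 2) (b := (p + 1) / 2)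
    (by linarith) (by linarith)
  rw [← image_sin_sq_Ioo, integrableOn_image_iff_integrableOn_abs_deriv_smul measurableSet_Ioo
    (fun θ _ => (hasDerivAt_sin_sq θ).hasDerivWithinAt) injOn_sin_sq] at h
  have h2 := h.congr_fun (fun θ hθ => abs_deriv_sin_sq_smul hθ) measurableSet_Ioo
  refine IntegrableOn.congr_fun (h2.const_mul (1 / 2)) (fun θ _ => ?_) measurableSet_Ioo
  ring

theorem two_mul_integral_cos_rpow_mul_sin_rpow {σ p : ℝ} (hσ : σ < 1) (hp : -1 < p) :
    2 * ∫ θ in Ioo 0 (π / 2), cos θ ^ p * sin θ ^ (-σ) = beta ((1 - σ) / 2) ((p + 1) / 2) := by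
  rw [← integral_rpow_mul_one_sub_rpow (by linarith) (by linarith), ← image_sin_sq_Ioo,
    integral_image_eq_integral_abs_deriv_smul measurableSet_Ioo
    (fun θ _ => (hasDerivAt_sin_sq θ).hasDerivWithinAt) injOn_sin_sq, ← integral_const_mul]
  exact (setIntegral_congr_fun measurableSet_Ioo fun θ hθ => abs_deriv_sin_sq_smul hθ).symm

theorem tendsto_integral_cos_rpow_mul_max_rpow {σ p ρ : ℝ} (hσ₀ : 0 < σ) (hσ : σ < 1)
    (hp : -1 < p) (hρ : 0 < ρ) :
    Tendsto (fun ε : ℝ => ∫ θ in Ioo 0 (π / 2), cos θ ^ p * max ε (2 * ρ * |sin θ|) ^ (-σ))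
      (𝓝[>] 0) (𝓝 (beta ((1 - σ) / 2) ((p + 1) / 2) / (2 * (2 * ρ) ^ σ))) := by
  have hlim : beta ((1 - σ) / 2) ((p + 1) / 2) / (2 * (2 * ρ) ^ σ) =
      ∫ θ in Ioo 0 (π / 2), (2 * ρ) ^ (-σ) * (cos θ ^ p * sin θ ^ (-σ)) := by
    rw [integral_const_mul, ← two_mul_integral_cos_rpow_mul_sin_rpow hσ hp,
      rpow_neg (by positivity)]
    have : (2 * ρ) ^ σ ≠ 0 := by positivity
    field_simp
  have hpos : ∀ θ ∈ Ioo (0 : ℝ) (π / 2), 0 < sin θ ∧ 0 < cos θ := fun θ hθ =>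
    ⟨sin_pos_of_pos_of_lt_pi hθ.1 (by linarith [hθ.2, pi_pos]),
      cos_pos_of_mem_Ioo ⟨by linarith [hθ.1, pi_pos], hθ.2⟩⟩
  have heq : ∀ θ ∈ Ioo (0 : ℝ) (π / 2), (2 * ρ) ^ (-σ) * (cos θ ^ p * sin θ ^ (-σ)) =
      cos θ ^ p * (2 * ρ * |sin θ|) ^ (-σ) := by
    intro θ hθ
    obtain ⟨hs, hc⟩ := hpos θ hθ
    rw [abs_of_pos hs, mul_rpow (by positivity) hs.le]
    ring
  rw [hlim]
  refine tendsto_integral_filter_of_dominated_convergence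
    (fun θ => (2 * ρ) ^ (-σ) * (cos θ ^ p * sin θ ^ (-σ))) ?_ ?_
    ((integrableOn_cos_rpow_mul_sin_rpow hσ hp).const_mul _) ?_
  · exact Eventually.of_forall fun ε => Measurable.aestronglyMeasurable (by fun_prop)
  · refine Eventually.of_forall fun ε => ?_
    filter_upwards [ae_restrict_mem measurableSet_Ioo] with θ hθ
    obtain ⟨hs, hc⟩ := hpos θ hθ
    have h2 : 0 < 2 * ρ * |sin θ| := by positivity
    have h3 : 0 < max ε (2 * ρ * |sin θ|) := lt_max_of_lt_right h2
    rw [heq θ hθ, norm_of_nonneg (by positivity)]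
    gcongr ?_ * ?_
    exact rpow_le_rpow_of_nonpos h2 (le_max_right _ _) (by linarith)
  · filter_upwards [ae_restrict_mem measurableSet_Ioo] with θ hθ
    obtain ⟨hs, hc⟩ := hpos θ hθ
    have h2 : 0 < 2 * ρ * |sin θ| := by positivity
    rw [heq θ hθ]
    refine tendsto_const_nhds.congr' ?_
    filter_upwards [nhdsWithin_le_nhds (Iio_mem_nhds h2)] with ε hε
    rw [max_eq_right (le_of_lt hε)]

end Beta

section Planar

open Real

/-- The half-plane `re > 0` without the ball of radius `ε`. -/
def truncatedHalfPlane (ε : ℝ) : Set ℂ := {w | 0 < w.re ∧ ε ≤ ‖w‖}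

/-- The kernel `t ^ p / |w| ^ (p + 2 + σ)`, where `t = re w`. -/
noncomputable def planeKernel (p σ : ℝ) (w : ℂ) : ℝ := w.re ^ p / ‖w‖ ^ (p + 2 + σ)

/-- The sign which is `1` in the closed disc of radius `ρ` centred at `-i ρ` and `-1` outside of it,
except on the real axis, where it vanishes. -/
noncomputable def discSign (ρ : ℝ) (w : ℂ) : ℝ :=
  if w.im < 0 ∧ ‖w‖ ^ 2 + 2 * ρ * w.im ≤ 0 then 1 else if w.im = 0 then 0 else -1

/-- The points outside the two discs of radius `ρ` centred at `± i ρ`. -/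
def discsCompl (ρ : ℝ) : Set ℂ := {w | 2 * ρ * |w.im| < ‖w‖ ^ 2}

theorem measurableSet_truncatedHalfPlane (ε : ℝ) : MeasurableSet (truncatedHalfPlane ε) :=
  (measurableSet_lt measurable_const Complex.measurable_re).inter
    (measurableSet_le measurable_const measurable_norm)

theorem measurableSet_discsCompl (ρ : ℝ) : MeasurableSet (discsCompl ρ) :=
  measurableSet_lt (Complex.measurable_im.abs.const_mul _) (measurable_norm.pow_const _)

theorem measurable_planeKernel (p σ : ℝ) : Measurable (planeKernel p σ) := by
  unfold planeKernel; fun_prop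

theorem measurable_discSign (ρ : ℝ) : Measurable (discSign ρ) := by
  refine Measurable.ite ?_ measurable_const
    (Measurable.ite ?_ measurable_const measurable_const)
  · exact (measurableSet_lt Complex.measurable_im measurable_const).inter
      (measurableSet_le ((measurable_norm.pow_const 2).add
        (Complex.measurable_im.const_mul (2 * ρ))) measurable_const)
  · exact measurableSet_eq_fun Complex.measurable_im measurable_const

theorem abs_discSign_le (ρ : ℝ) (w : ℂ) : |discSign ρ w| ≤ 1 := by
  unfold discSign; split_ifs <;> simp

theorem planeKernel_nonneg {p σ : ℝ} {w : ℂ} (hw : 0 < w.re) : 0 ≤ planeKernel p σ w := by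
  unfold planeKernel; positivity

theorem planeKernel_le {p σ ε : ℝ} (hp : 0 ≤ p) (hσ : 0 < σ) (hε : 0 < ε) {w : ℂ}
    (hw : w ∈ truncatedHalfPlane ε) :
    planeKernel p σ w ≤ (1 + ε⁻¹) ^ (2 + σ) * (1 + ‖w‖) ^ (-(2 + σ)) := by
  obtain ⟨hre, hn⟩ := hw
  have hpos : 0 < ‖w‖ := hε.trans_le hn
  have h1 : w.re ^ p ≤ ‖w‖ ^ p := rpow_le_rpow hre.le (Complex.re_le_norm w) hp
  have h2 : 1 + ‖w‖ ≤ (1 + ε⁻¹) * ‖w‖ := by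
    have : 1 ≤ ε⁻¹ * ‖w‖ := by rw [inv_mul_eq_div, one_le_div hε]; exact hn
    linarith
  have h3 : (1 + ‖w‖) ^ (2 + σ) ≤ (1 + ε⁻¹) ^ (2 + σ) * ‖w‖ ^ (2 + σ) := by
    rw [← mul_rpow (by positivity) hpos.le]
    exact rpow_le_rpow (by positivity) h2 (by linarith)
  rw [planeKernel, rpow_neg (by positivity), ← div_eq_mul_inv, add_assoc, rpow_add hpos,
    div_le_div_iff₀ (by positivity) (by positivity)]
  calc w.re ^ p * (1 + ‖w‖) ^ (2 + σ)
      ≤ ‖w‖ ^ p * ((1 + ε⁻¹) ^ (2 + σ) * ‖w‖ ^ (2 + σ)) := by gcongr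
    _ = _ := by ring

theorem integrableOn_planeKernel {p σ ε : ℝ} (hp : 0 ≤ p) (hσ : 0 < σ) (hε : 0 < ε) :
    IntegrableOn (planeKernel p σ) (truncatedHalfPlane ε) := by
  have hdim : (Module.finrank ℝ ℂ : ℝ) < 2 + σ := by
    rw [Complex.finrank_real_complex]; push_cast; linarith
  refine Integrable.mono' (((integrable_one_add_norm (μ := (volume : Measure ℂ))
    hdim).const_mul ((1 + ε⁻¹) ^ (2 + σ))).integrableOn (s := truncatedHalfPlane ε))
    (measurable_planeKernel p σ).aestronglyMeasurable ?_
  filter_upwards [ae_restrict_mem (measurableSet_truncatedHalfPlane ε)] with w hw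
  rw [norm_of_nonneg (planeKernel_nonneg hw.1)]
  exact planeKernel_le hp hσ hε hw

theorem integrableOn_planeKernel_mul_discSign {p σ ε : ℝ} (ρ : ℝ) (hp : 0 ≤ p) (hσ : 0 < σ)
    (hε : 0 < ε) :
    IntegrableOn (fun w => planeKernel p σ w * discSign ρ w) (truncatedHalfPlane ε) := by
  refine Integrable.mul_bdd (c := 1) (integrableOn_planeKernel hp hσ hε)
    (measurable_discSign ρ).aestronglyMeasurable (ae_of_all _ fun w => ?_)
  exact abs_discSign_le ρ w

theorem ae_im_ne_zero : ∀ᵐ w : ℂ, w.im ≠ 0 := by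
  have h : volume (LinearMap.ker Complex.imLm : Set ℂ) = 0 := by
    refine Measure.addHaar_submodule _ _ fun h => ?_
    have : Complex.I ∈ LinearMap.ker Complex.imLm := h ▸ Submodule.mem_top
    simp at this
  refine measure_mono_null (fun w hw => ?_) h
  simpa using hw

theorem discSign_add_discSign_conj (ρ : ℝ) {w : ℂ} (hw : w.im ≠ 0) :
    discSign ρ w + discSign ρ (starRingEnd ℂ w) =
      (discsCompl ρ).indicator (fun _ => -2) w := by
  classical
  simp only [discSign, indicator_apply, discsCompl, mem_ofPred_eq, Complex.conj_im, RCLike.norm_conj, neg_eq_zero,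
    hw, if_false, neg_lt_zero, mul_neg]
  rcases lt_or_gt_of_ne hw with h | h
  · simp only [abs_of_neg h, h, h.not_gt, true_and, false_and, if_false, mul_neg]
    by_cases h' : ‖w‖ ^ 2 + 2 * ρ * w.im ≤ 0
    · rw [if_pos h', if_neg (by linarith)]; norm_num
    · rw [if_neg h', if_pos (by linarith)]; norm_num
  · simp only [abs_of_pos h, h, h.not_gt, true_and, false_and, if_false]
    by_cases h' : ‖w‖ ^ 2 + -(2 * ρ * w.im) ≤ 0
    · rw [if_pos h', if_neg (by linarith)]; norm_num
    · rw [if_neg h', if_pos (by linarith)]; norm_num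

theorem setIntegral_planeKernel_mul_discSign {p σ ε ρ : ℝ} (hp : 0 ≤ p) (hσ : 0 < σ)
    (hε : 0 < ε) :
    ∫ w in truncatedHalfPlane ε, planeKernel p σ w * discSign ρ w =
      -∫ w in truncatedHalfPlane ε ∩ discsCompl ρ, planeKernel p σ w := by
  set D := truncatedHalfPlane ε with hD
  have hDm : MeasurableSet D := measurableSet_truncatedHalfPlane ε
  set g : ℂ → ℝ := D.indicator fun w => planeKernel p σ w * discSign ρ w with hg
  have hgi : Integrable g :=
    (integrable_indicator_iff hDm).2 (integrableOn_planeKernel_mul_discSign ρ hp hσ hε)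
  have hmp := Complex.conjLIE.measurePreserving
  have hemb : MeasurableEmbedding Complex.conjLIE :=
    Complex.conjLIE.toHomeomorph.measurableEmbedding
  have hconj : ∫ w, g (Complex.conjLIE w) = ∫ w, g w := hmp.integral_comp hemb g
  have hci : Integrable fun w => g (Complex.conjLIE w) := (hmp.integrable_comp_emb hemb).2 hgi
  have hsum : ∫ w, (g w + g (Complex.conjLIE w)) =
      ∫ w, -2 * (D ∩ discsCompl ρ).indicator (planeKernel p σ) w := by
    refine integral_congr_ae ?_
    filter_upwards [ae_im_ne_zero] with w hw
    classical
    have hmem : (starRingEnd ℂ w ∈ D) ↔ w ∈ D := by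
      simp [hD, truncatedHalfPlane]
    have hker : planeKernel p σ (starRingEnd ℂ w) = planeKernel p σ w := by
      simp [planeKernel]
    have h := discSign_add_discSign_conj ρ hw
    simp only [hg, Complex.conjLIE_apply, indicator_apply, hmem, hker, mem_inter_iff] at h ⊢
    by_cases h1 : w ∈ D <;> by_cases h2 : w ∈ discsCompl ρ <;>
      simp only [h1, h2, if_true, if_false, and_true, and_false, and_self] at h ⊢
    · rw [← mul_add, h]; ring
    · rw [← mul_add, h]; ring
    · ring
    · ring
  rw [integral_add hgi hci, hconj, integral_const_mul,
    integral_indicator (hDm.inter (measurableSet_discsCompl ρ)), hg, integral_indicator hDm] at hsum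
  linarith

theorem integral_rpow_indicator {σ ε a : ℝ} (hσ : 0 < σ) (hε : 0 < ε) :
    ∫ r in Ioi (0 : ℝ), {r : ℝ | ε ≤ r ∧ a < r}.indicator (fun r => r ^ (-1 - σ)) r =
      max ε a ^ (-σ) / σ := by
  have hm : 0 < max ε a := lt_max_of_lt_left hε
  have hms : MeasurableSet {r : ℝ | ε ≤ r ∧ a < r} := measurableSet_Ici.inter measurableSet_Ioi
  have hset : Ioi (0 : ℝ) ∩ {r : ℝ | ε ≤ r ∧ a < r} = {r : ℝ | ε ≤ r ∧ a < r} :=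
    inter_eq_right.2 fun r hr => hε.trans_le hr.1
  have hae : ({r : ℝ | ε ≤ r ∧ a < r} : Set ℝ) =ᵐ[volume] Ioi (max ε a) := by
    have : Ioi (max ε a) = Ioi ε ∩ Ioi a := by ext; simp
    rw [this]
    exact Ioi_ae_eq_Ici.symm.inter (ae_eq_refl _)
  rw [setIntegral_indicator hms, hset, setIntegral_congr_set hae,
    integral_Ioi_rpow_of_lt (by linarith) hm]
  rw [show -1 - σ + 1 = -σ by ring, neg_div_neg_eq]

/-- The radial-angular integrand of `planeKernel` off the two discs. -/
noncomputable def polarIntegrand (p σ ε ρ : ℝ) (q : ℝ × ℝ) : ℝ :=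
  (if 0 < cos q.2 then cos q.2 ^ p else 0) *
    {r : ℝ | ε ≤ r ∧ 2 * ρ * |sin q.2| < r}.indicator (fun r => r ^ (-1 - σ)) q.1

theorem measurable_polarIntegrand (p σ ε ρ : ℝ) : Measurable (polarIntegrand p σ ε ρ) := by
  classical
  unfold polarIntegrand
  refine Measurable.mul (Measurable.ite (measurableSet_lt (by fun_prop) (by fun_prop))
    (by fun_prop) (by fun_prop)) ?_
  simp only [indicator_apply, mem_ofPred_eq]
  have h₁ : MeasurableSet {q : ℝ × ℝ | ε ≤ q.1} :=
    measurableSet_le measurable_const measurable_fst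
  have h₂ : MeasurableSet {q : ℝ × ℝ | 2 * ρ * |sin q.2| < q.1} :=
    measurableSet_lt (by fun_prop) measurable_fst
  exact Measurable.ite (h₁.inter h₂) (by fun_prop) (by fun_prop)

theorem integrable_polarIntegrand {p σ ε ρ : ℝ} (hp : 0 ≤ p) (hσ : 0 < σ) (hε : 0 < ε) :
    Integrable (polarIntegrand p σ ε ρ)
      ((volume.restrict (Ioi 0)).prod (volume.restrict (Ioo (-π) π))) := by
  have h1 : Integrable ((Ici ε).indicator fun r : ℝ => r ^ (-1 - σ)) (volume.restrict (Ioi 0)) := by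
    refine Integrable.restrict ?_
    rw [integrable_indicator_iff measurableSet_Ici, integrableOn_Ici_iff_integrableOn_Ioi]
    exact integrableOn_Ioi_rpow_of_lt (by linarith) hε
  have h2 : Integrable (fun _ : ℝ => (1 : ℝ)) (volume.restrict (Ioo (-π) π)) :=
    integrable_const _
  refine (h1.mul_prod h2).mono' (measurable_polarIntegrand p σ ε ρ).aestronglyMeasurable
    (ae_of_all _ fun q => ?_)
  have ha : |if 0 < cos q.2 then cos q.2 ^ p else 0| ≤ 1 := by
    split_ifs with h
    · rw [abs_of_nonneg (by positivity)]
      exact rpow_le_one h.le (cos_le_one _) hp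
    · simp
  have hb : |{r : ℝ | ε ≤ r ∧ 2 * ρ * |sin q.2| < r}.indicator (fun r => r ^ (-1 - σ)) q.1| ≤
      (Ici ε).indicator (fun r : ℝ => r ^ (-1 - σ)) q.1 := by
    by_cases h : q.1 ∈ {r : ℝ | ε ≤ r ∧ 2 * ρ * |sin q.2| < r}
    · have h0 : 0 < q.1 := hε.trans_le h.1
      rw [indicator_of_mem h, indicator_of_mem (show q.1 ∈ Ici ε from h.1),
        abs_of_nonneg (by positivity)]
    · rw [indicator_of_notMem h, abs_zero]
      exact indicator_nonneg (fun r hr => rpow_nonneg (hε.le.trans hr) _) _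
  rw [polarIntegrand, norm_eq_abs, abs_mul]
  calc _ ≤ 1 * (Ici ε).indicator (fun r : ℝ => r ^ (-1 - σ)) q.1 := by gcongr
    _ = _ := by ring

theorem smul_indicator_planeKernel_polarCoord {p σ ε ρ : ℝ} (q : ℝ × ℝ) (hq : 0 < q.1) :
    q.1 • (truncatedHalfPlane ε ∩ discsCompl ρ).indicator (planeKernel p σ)
      (Complex.polarCoord.symm q) = polarIntegrand p σ ε ρ q := by
  classical
  obtain ⟨r, θ⟩ := q
  simp only at hq
  have hre : (Complex.polarCoord.symm (r, θ)).re = r * cos θ := by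
    simp [-Complex.ofReal_cos]
  have him : (Complex.polarCoord.symm (r, θ)).im = r * sin θ := by
    simp [-Complex.ofReal_sin]
  have hnorm : ‖Complex.polarCoord.symm (r, θ)‖ = r := by
    rw [Complex.norm_polarCoord_symm, abs_of_pos hq]
  have hmem : Complex.polarCoord.symm (r, θ) ∈ truncatedHalfPlane ε ∩ discsCompl ρ ↔
      0 < cos θ ∧ (ε ≤ r ∧ 2 * ρ * |sin θ| < r) := by
    simp only [truncatedHalfPlane, discsCompl, mem_inter_iff, mem_ofPred_eq, hre, him, hnorm,
      abs_mul, abs_of_pos hq, mul_pos_iff_of_pos_left hq, and_assoc]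
    rw [show 2 * ρ * (r * |sin θ|) = r * (2 * ρ * |sin θ|) by ring, sq, mul_lt_mul_iff_right₀ hq]
  simp only [polarIntegrand, indicator_apply, hmem, mem_ofPred_eq, planeKernel, hre, hnorm]
  by_cases h1 : 0 < cos θ <;> by_cases h2 : ε ≤ r ∧ 2 * ρ * |sin θ| < r
  · simp only [h1, h2, and_self, if_true, smul_eq_mul]
    rw [mul_rpow hq.le h1.le, add_assoc, rpow_add hq, show -1 - σ = 1 - (2 + σ) by ring,
      rpow_sub hq, rpow_one]
    have := (rpow_pos_of_pos hq p).ne'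
    field_simp
  all_goals simp only [h1, h2, and_self, and_true, and_false, if_true,
    if_false, smul_zero, mul_zero, zero_mul]

theorem setIntegral_planeKernel {p σ ε ρ : ℝ} (hp : 0 ≤ p) (hσ : 0 < σ) (hε : 0 < ε) :
    ∫ w in truncatedHalfPlane ε ∩ discsCompl ρ, planeKernel p σ w =
      2 / σ * ∫ θ in Ioo 0 (π / 2), cos θ ^ p * max ε (2 * ρ * |sin θ|) ^ (-σ) := by
  have htarget : MeasurableSet (Ioi (0 : ℝ) ×ˢ Ioo (-π) π) :=
    measurableSet_Ioi.prod measurableSet_Ioo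
  set f : ℝ → ℝ := (Iio (π / 2)).indicator
    fun θ => cos θ ^ p * (max ε (2 * ρ * |sin θ|) ^ (-σ) / σ) with hf
  have hangle : ∀ θ ∈ Ioo (-π) π, (if 0 < cos θ then cos θ ^ p else 0) *
      (max ε (2 * ρ * |sin θ|) ^ (-σ) / σ) = f |θ| := by
    intro θ hθ
    classical
    have habs : |sin (|θ|)| = |sin θ| := by
      rcases abs_choice θ with h | h <;> rw [h]
      rw [sin_neg, abs_neg]
    simp only [hf, indicator_apply, mem_Iio, cos_abs, habs]
    by_cases h : |θ| < π / 2
    · rw [if_pos h, if_pos (cos_pos_of_mem_Ioo (abs_lt.1 h))]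
    · rw [if_neg h, if_neg, zero_mul]
      rw [not_lt, ← cos_abs]
      exact cos_nonpos_of_pi_div_two_le_of_le (not_lt.1 h)
        (by linarith [abs_lt.2 hθ, pi_pos])
  calc ∫ w in truncatedHalfPlane ε ∩ discsCompl ρ, planeKernel p σ w
      = ∫ q in Ioi (0 : ℝ) ×ˢ Ioo (-π) π, polarIntegrand p σ ε ρ q := by
        rw [← integral_indicator ((measurableSet_truncatedHalfPlane ε).inter
          (measurableSet_discsCompl ρ)), ← Complex.integral_comp_polarCoord_symm]
        exact setIntegral_congr_fun htarget fun q hq =>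
          smul_indicator_planeKernel_polarCoord q hq.1
    _ = ∫ θ in Ioo (-π) π, ∫ r in Ioi (0 : ℝ), polarIntegrand p σ ε ρ (r, θ) := by
        rw [Measure.volume_eq_prod, ← Measure.prod_restrict]
        exact integral_prod_symm _ (integrable_polarIntegrand hp hσ hε)
    _ = ∫ θ in Ioo (-π) π, f |θ| := by
        refine setIntegral_congr_fun measurableSet_Ioo fun θ hθ => ?_
        simp only [polarIntegrand]
        rw [integral_const_mul, integral_rpow_indicator hσ hε, hangle θ hθ]
    _ = ∫ θ, f |θ| := by
        refine setIntegral_eq_integral_of_forall_compl_eq_zero fun θ hθ => ?_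
        refine indicator_of_notMem (fun h => hθ ?_) _
        exact abs_lt.1 (lt_trans h (by linarith [pi_pos]))
    _ = 2 * ∫ θ in Ioi 0, f θ := integral_comp_abs
    _ = _ := by
        rw [hf, setIntegral_indicator measurableSet_Iio, Ioi_inter_Iio]
        simp_rw [← mul_div_assoc]
        rw [integral_div]
        ring

theorem tendsto_setIntegral_planeKernel_mul_discSign {p σ ρ : ℝ} (hp : 0 ≤ p) (hσ₀ : 0 < σ)
    (hσ₁ : σ < 1) (hρ : 0 < ρ) :
    Tendsto (fun ε => ∫ w in truncatedHalfPlane ε, planeKernel p σ w * discSign ρ w) (𝓝[>] 0)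
      (𝓝 (-(ProbabilityTheory.beta ((1 - σ) / 2) ((p + 1) / 2) / (σ * (2 * ρ) ^ σ)))) := by
  have h := ((tendsto_integral_cos_rpow_mul_max_rpow hσ₀ hσ₁ (by linarith : -1 < p)
    hρ).const_mul (2 / σ)).neg
  have hlim : 2 / σ * (ProbabilityTheory.beta ((1 - σ) / 2) ((p + 1) / 2) / (2 * (2 * ρ) ^ σ)) =
      ProbabilityTheory.beta ((1 - σ) / 2) ((p + 1) / 2) / (σ * (2 * ρ) ^ σ) := by
    have : (2 * ρ) ^ σ ≠ 0 := by positivity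
    field_simp
  rw [hlim] at h
  refine h.congr' ?_
  filter_upwards [self_mem_nhdsWithin] with ε hε
  rw [setIntegral_planeKernel_mul_discSign hp hσ₀ hε, setIntegral_planeKernel hp hσ₀ hε]

end Planar

section Moment

variable {F : Type*} [NormedAddCommGroup F] [InnerProductSpace ℝ F]

/-- The action of a linear isometry on the unit sphere. -/
def sphereMap (U : F ≃ₗᵢ[ℝ] F) (e : sphere (0 : F) 1) : sphere (0 : F) 1 :=
  ⟨U e, by simp⟩

theorem continuous_rankOne_sphere : Continuous fun e : sphere (0 : F) 1 =>
    InnerProductSpace.rankOne ℝ (e : F) (e : F) :=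
  (InnerProductSpace.rankOne ℝ (E := F) (F := F)).continuous₂.comp
    (continuous_subtype_val.prodMk continuous_subtype_val)

variable [FiniteDimensional ℝ F] [MeasurableSpace F] [BorelSpace F]

open scoped Pointwise in
theorem measurePreserving_sphereMap (U : F ≃ₗᵢ[ℝ] F) :
    MeasurePreserving (sphereMap U) (unitSphereMeasure F) (unitSphereMeasure F) := by
  have hm : Measurable (sphereMap U) :=
    Measurable.subtype_mk (U.continuous.measurable.comp measurable_subtype_coe)
  refine ⟨hm, ?_⟩
  ext s hs
  rw [Measure.map_apply hm hs, unitSphereMeasure, Measure.toSphere_apply' _ (hm hs),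
    Measure.toSphere_apply' _ hs]
  congr 1
  rw [← U.measurePreserving.measure_preimage_equiv (f := U.toMeasurableEquiv)
    (Ioo (0 : ℝ) 1 • (Subtype.val '' s))]
  congr 1
  ext x
  constructor
  · rintro ⟨r, hr, _, ⟨e, hes, rfl⟩, hx⟩
    refine ⟨r, hr, _, ⟨sphereMap U e, hes, rfl⟩, ?_⟩
    change r • U e = U x
    rw [← hx]
    exact (map_smul U r _).symm
  · rintro ⟨r, hr, _, ⟨e, hes, rfl⟩, hx⟩
    refine ⟨r, hr, _, ⟨sphereMap U.symm e, ?_, rfl⟩, U.injective ?_⟩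
    · simpa [sphereMap] using hes
    · change U (r • U.symm e) = U x
      rw [map_smul, U.apply_symm_apply]
      exact hx

instance : IsFiniteMeasure (unitSphereMeasure F) :=
  inferInstanceAs (IsFiniteMeasure (volume : Measure F).toSphere)

theorem integrable_of_continuous_sphere {G : Type*} [NormedAddCommGroup G]
    [SecondCountableTopology G] {f : sphere (0 : F) 1 → G} (hf : Continuous f) :
    Integrable f (unitSphereMeasure F) := by
  borelize G
  exact hf.integrable_of_hasCompactSupport (HasCompactSupport.of_compactSpace f)

theorem integrable_rankOne_sphere : Integrable (fun e : sphere (0 : F) 1 =>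
    InnerProductSpace.rankOne ℝ (e : F) (e : F)) (unitSphereMeasure F) :=
  integrable_of_continuous_sphere continuous_rankOne_sphere

theorem integral_inner_sq_eq_of_norm_eq {u v : F} (h : ‖u‖ = ‖v‖) :
    ∫ e : sphere (0 : F) 1, ⟪(e : F), u⟫ ^ 2 ∂unitSphereMeasure F =
      ∫ e : sphere (0 : F) 1, ⟪(e : F), v⟫ ^ 2 ∂unitSphereMeasure F := by
  set U := (Submodule.span ℝ {u - v})ᗮ.reflection
  have hU : U u = v := Submodule.reflection_sub h
  have hmap := (measurePreserving_sphereMap U).map_eq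
  conv_rhs => rw [← hmap]
  rw [integral_map (measurePreserving_sphereMap U).aemeasurable
    (Continuous.aestronglyMeasurable (by fun_prop))]
  refine integral_congr_ae (ae_of_all _ fun e => ?_)
  simp only [sphereMap, ← hU, LinearIsometryEquiv.inner_map_map]

theorem integral_inner_sq (u : F) :
    Module.finrank ℝ F * ∫ e : sphere (0 : F) 1, ⟪(e : F), u⟫ ^ 2 ∂unitSphereMeasure F =
      (unitSphereMeasure F).real univ * ‖u‖ ^ 2 := by
  let b := stdOrthonormalBasis ℝ F
  have hb : ∀ i, ∫ e : sphere (0 : F) 1, ⟪(e : F), u⟫ ^ 2 ∂unitSphereMeasure F =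
      ∫ e : sphere (0 : F) 1, ‖u‖ ^ 2 * ⟪b i, (e : F)⟫ ^ 2 ∂unitSphereMeasure F := by
    intro i
    rw [integral_inner_sq_eq_of_norm_eq (v := ‖u‖ • b i) (by simp [norm_smul])]
    refine integral_congr_ae (ae_of_all _ fun e => ?_)
    simp only [real_inner_smul_right, mul_pow, real_inner_comm]
  calc Module.finrank ℝ F * ∫ e : sphere (0 : F) 1, ⟪(e : F), u⟫ ^ 2 ∂unitSphereMeasure F
      = ∑ i : Fin (Module.finrank ℝ F),
          ∫ e : sphere (0 : F) 1, ‖u‖ ^ 2 * ⟪b i, (e : F)⟫ ^ 2 ∂unitSphereMeasure F := by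
        rw [← Finset.sum_congr rfl fun i _ => hb i]; simp
    _ = ∫ e : sphere (0 : F) 1, ‖u‖ ^ 2 ∂unitSphereMeasure F := by
        rw [← integral_finsetSum _ fun i _ => integrable_of_continuous_sphere (by fun_prop)]
        refine integral_congr_ae (ae_of_all _ fun e => ?_)
        simp [← Finset.mul_sum, OrthonormalBasis.sum_sq_inner_right]
    _ = _ := by simp

theorem finrank_smul_integral_rankOne :
    (Module.finrank ℝ F : ℝ) • ∫ e : sphere (0 : F) 1,
        InnerProductSpace.rankOne ℝ (e : F) (e : F) ∂unitSphereMeasure F =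
      (unitSphereMeasure F).real univ • ContinuousLinearMap.id ℝ F := by
  have hint := integrable_rankOne_sphere (F := F)
  set A := ∫ e : sphere (0 : F) 1,
        InnerProductSpace.rankOne ℝ (e : F) (e : F) ∂unitSphereMeasure F with hA
  have hAuv : ∀ u v : F, ⟪A u, v⟫ =
      ∫ e : sphere (0 : F) 1, ⟪(e : F), u⟫ * ⟪(e : F), v⟫ ∂unitSphereMeasure F := by
    intro u v
    rw [hA, ContinuousLinearMap.integral_apply hint, real_inner_comm,
      ← integral_inner (hint.apply_continuousLinearMap u)]
    refine integral_congr_ae (ae_of_all _ fun e => ?_)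
    simp [real_inner_smul_right, real_inner_comm v]
  rw [← sub_eq_zero]
  set B := (Module.finrank ℝ F : ℝ) • A -
    (unitSphereMeasure F).real univ • ContinuousLinearMap.id ℝ F with hB
  have hBuv : ∀ u v : F, ⟪B u, v⟫ = Module.finrank ℝ F * ⟪A u, v⟫ -
      (unitSphereMeasure F).real univ * ⟪u, v⟫ := by
    intro u v
    simp [hB, inner_sub_left, real_inner_smul_left]
  have hsymm : (B : F →ₗ[ℝ] F).IsSymmetric := by
    intro u v
    simp only [ContinuousLinearMap.coe_coe]
    rw [hBuv, real_inner_comm (B v), hBuv, hAuv, hAuv, real_inner_comm u v]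
    simp_rw [mul_comm ⟪_, u⟫]
  have h0 : (B : F →ₗ[ℝ] F) = 0 := by
    rw [← hsymm.inner_map_self_eq_zero]
    intro u
    simp only [ContinuousLinearMap.coe_coe]
    rw [hBuv, hAuv, real_inner_self_eq_norm_sq, ← integral_inner_sq, sub_eq_zero]
    simp only [sq]
  ext u
  exact congrArg (fun T : F →ₗ[ℝ] F => T u) h0

theorem unitSphereMeasure_real_univ_eq_omega :
    (unitSphereMeasure F).real univ = omega (Module.finrank ℝ F) := by
  rw [omega, unitSphereMeasure, unitSphereMeasure, Measure.toSphere_real_apply_univ,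
    Measure.toSphere_real_apply_univ, finrank_euclideanSpace_fin, measureReal_def, measureReal_def,
    ← (stdOrthonormalBasis ℝ F).measurePreserving_repr_symm.measure_preimage
      measurableSet_ball.nullMeasurableSet]
  simp

theorem omega_pos {d : ℕ} (hd : 0 < d) : 0 < omega d := by
  rw [omega, unitSphereMeasure, Measure.toSphere_real_apply_univ, finrank_euclideanSpace_fin]
  have : 0 < (volume : Measure (EuclideanSpace ℝ (Fin d))).real (ball 0 1) :=
    ENNReal.toReal_pos (measure_ball_pos _ _ one_pos).ne' measure_ball_lt_top.ne
  positivity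

theorem sphereIntegrable_const (a k : ℝ) : SphereIntegrable F a fun _ => k :=
  ((integrable_rankOne_sphere.smul a).sub (integrable_const _)).smul k

theorem finrank_smul_sphereIntegral_const (a k : ℝ) :
    (Module.finrank ℝ F : ℝ) • sphereIntegral F a (fun _ => k) =
      (k * (a - Module.finrank ℝ F) * omega (Module.finrank ℝ F)) •
        ContinuousLinearMap.id ℝ F := by
  unfold sphereIntegral sphereIntegrand
  rw [integral_smul, integral_sub (integrable_rankOne_sphere.fun_smul a) (integrable_const _), integral_smul,
    integral_const, smul_comm, smul_sub, smul_comm _ a, finrank_smul_integral_rankOne,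
    unitSphereMeasure_real_univ_eq_omega]
  module

end Moment

section Directional

variable {n : ℕ}

theorem norm_sphereNormal {c z : EuclideanSpace ℝ (Fin n)} {ρ : ℝ} (hρ : 0 < ρ)
    (hz : z ∈ sphere c ρ) : ‖sphereNormal c ρ z‖ = 1 := by
  have h : ‖z - c‖ = ρ := by simpa [dist_eq_norm] using hz
  rw [sphereNormal, norm_smul, h, Real.norm_of_nonneg (by positivity), inv_mul_cancel₀ hρ.ne']

theorem sub_center_eq_smul_sphereNormal (c z : EuclideanSpace ℝ (Fin n)) {ρ : ℝ} (hρ : 0 < ρ) :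
    z - c = ρ • sphereNormal c ρ z := by
  rw [sphereNormal, smul_inv_smul₀ hρ.ne']

theorem norm_sub_lineProj_planeMap (z : EuclideanSpace ℝ (Fin n)) {e u : EuclideanSpace ℝ (Fin n)}
    (he : ‖e‖ = 1) (heu : ⟪e, u⟫ = 0) {w : ℂ} (hw : 0 < w.re) :
    ‖z - lineProj z e (planeMap z e u w)‖ = w.re := by
  rw [lineProj, planeMap_sub, Submodule.starProjection_unit_singleton ℝ he, inner_add_right,
    real_inner_smul_right, real_inner_smul_right, heu, real_inner_self_eq_norm_sq, he,
    sub_add_cancel_left, norm_neg]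
  simp [norm_smul, he, abs_of_pos hw]

theorem directionalIntegrand_sphere_planeMap {c z e : EuclideanSpace ℝ (Fin n)} {ρ : ℝ} (σ : ℝ)
    (hρ : 0 < ρ) (hz : z ∈ sphere c ρ) (he : ‖e‖ = 1) (heu : ⟪e, sphereNormal c ρ z⟫ = 0)
    {w : ℂ} (hw : 0 < w.re) :
    directionalIntegrand (sphere c ρ) (sphereNormal c ρ) σ z e
        (planeMap z e (sphereNormal c ρ z) w) =
      planeKernel ((n : ℝ) - 2) σ w * discSign ρ w := by
  set u := sphereNormal c ρ z with hu
  have hu1 : ‖u‖ = 1 := norm_sphereNormal hρ hz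
  have hnorm := norm_re_smul_add_im_smul he hu1 heu w
  have hw0 : w ≠ 0 := fun h => by simp [h] at hw
  have hv : w.re • e + w.im • u ≠ 0 := by
    rw [← norm_pos_iff, hnorm]; exact norm_pos_iff.2 hw0
  have hy : planeMap z e u w = z + (w.re • e + w.im • u) := add_assoc _ _ _
  have hinner : ⟪z - c, w.re • e + w.im • u⟫ = ρ * w.im := by
    rw [sub_center_eq_smul_sphereNormal c z hρ, ← hu, real_inner_smul_left, inner_add_right,
      real_inner_smul_right, real_inner_smul_right, real_inner_comm, heu,
      real_inner_self_eq_norm_sq, hu1]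
    ring
  have hchi : chiHat (sphere c ρ) (sphereNormal c ρ) z (planeMap z e u w) = discSign ρ w := by
    rw [hy, chiHat_sphere_add hρ hz hv, hinner, hnorm]
    simp only [discSign, mul_neg_iff, hρ, hρ.not_gt, hρ.ne', true_and, false_and, or_false,
      mul_eq_zero, false_or, mul_assoc]
  have hzy : ‖z - planeMap z e u w‖ = ‖w‖ := by
    rw [norm_sub_rev, planeMap_sub, hnorm]
  rw [directionalIntegrand, norm_sub_lineProj_planeMap z he heu hw, hchi, hzy, planeKernel,
    sub_add_cancel]
  ring

theorem halfPlane_subset_range (ν : EuclideanSpace ℝ (Fin n) → EuclideanSpace ℝ (Fin n))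
    (z e : EuclideanSpace ℝ (Fin n)) : halfPlane ν z e ⊆ range (planeMap z e (ν z)) := by
  rintro _ ⟨t, h, -, rfl⟩
  exact ⟨⟨t, h⟩, rfl⟩

theorem planeMap_preimage_halfPlane_diff_ball
    {ν : EuclideanSpace ℝ (Fin n) → EuclideanSpace ℝ (Fin n)} {z e : EuclideanSpace ℝ (Fin n)}
    (he : ‖e‖ = 1) (hu : ‖ν z‖ = 1) (heu : ⟪e, ν z⟫ = 0) (ε : ℝ) :
    planeMap z e (ν z) ⁻¹' (halfPlane ν z e \ ball z ε) = truncatedHalfPlane ε := by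
  have hinj := (isometry_planeMap z he hu heu).injective
  ext w
  have h1 : planeMap z e (ν z) w ∈ halfPlane ν z e ↔ 0 < w.re := by
    constructor
    · rintro ⟨t, h, ht, heq⟩
      have : w = ⟨t, h⟩ := hinj heq
      rw [this]; exact ht
    · exact fun h => ⟨w.re, w.im, h, rfl⟩
  rw [mem_preimage, Set.mem_sdiff, h1, mem_ball, dist_eq_norm, planeMap_sub,
    norm_re_smul_add_im_smul he hu heu, not_lt]
  rfl

theorem restrict_euclideanHausdorffMeasure_halfPlane
    {ν : EuclideanSpace ℝ (Fin n) → EuclideanSpace ℝ (Fin n)} {z e : EuclideanSpace ℝ (Fin n)}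
    (he : ‖e‖ = 1) (hu : ‖ν z‖ = 1) (heu : ⟪e, ν z⟫ = 0) (ε : ℝ) :
    (Measure.euclideanHausdorffMeasure 2).restrict (halfPlane ν z e \ ball z ε) =
      ((volume : Measure ℂ).map (planeMap z e (ν z))).restrict (halfPlane ν z e \ ball z ε) := by
  rw [map_planeMap z he hu heu, Measure.restrict_restrict_of_subset
    (sdiff_subset.trans (halfPlane_subset_range ν z e))]

theorem hasNonlocalDirectionalCurvature_sphere (hn : 2 ≤ n) {σ : ℝ} (hσ₀ : 0 < σ) (hσ₁ : σ < 1)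
    {ρ : ℝ} (hρ : 0 < ρ) {c z e : EuclideanSpace ℝ (Fin n)} (hz : z ∈ sphere c ρ)
    (het : e ∈ tangentSpace (sphereNormal c ρ) z) (he : ‖e‖ = 1) :
    HasNonlocalDirectionalCurvature (sphere c ρ) (sphereNormal c ρ) σ z e
      (-(ProbabilityTheory.beta ((1 - σ) / 2) (((n : ℝ) - 1) / 2) / (σ * (2 * ρ) ^ σ))) := by
  have hu : ‖sphereNormal c ρ z‖ = 1 := norm_sphereNormal hρ hz
  have heu : ⟪e, sphereNormal c ρ z⟫ = 0 := by
    rw [real_inner_comm]; exact Submodule.mem_orthogonal_singleton_iff_inner_right.1 het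
  have hp : 0 ≤ (n : ℝ) - 2 := by
    have : (2 : ℝ) ≤ n := by exact_mod_cast hn
    linarith
  have hemb : MeasurableEmbedding (planeMap z e (sphereNormal c ρ z)) :=
    (isometry_planeMap z he hu heu).isClosedEmbedding.measurableEmbedding
  have hcongr : ∀ ε : ℝ, EqOn (directionalIntegrand (sphere c ρ) (sphereNormal c ρ) σ z e ∘
      planeMap z e (sphereNormal c ρ z))
      (fun w => planeKernel ((n : ℝ) - 2) σ w * discSign ρ w) (truncatedHalfPlane ε) :=
    fun ε w hw => directionalIntegrand_sphere_planeMap σ hρ hz he heu hw.1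
  constructor
  · intro ε hε
    rw [IntegrableOn, restrict_euclideanHausdorffMeasure_halfPlane he hu heu, ← IntegrableOn,
      hemb.integrableOn_map_iff, planeMap_preimage_halfPlane_diff_ball he hu heu,
      integrableOn_congr_fun (hcongr ε) (measurableSet_truncatedHalfPlane ε)]
    exact integrableOn_planeKernel_mul_discSign ρ hp hσ₀ hε
  · have htrunc : truncatedDirectionalCurvature (sphere c ρ) (sphereNormal c ρ) σ z e = fun ε =>
        ∫ w in truncatedHalfPlane ε, planeKernel ((n : ℝ) - 2) σ w * discSign ρ w := by
      ext ε
      rw [truncatedDirectionalCurvature, restrict_euclideanHausdorffMeasure_halfPlane he hu heu,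
        hemb.setIntegral_map, planeMap_preimage_halfPlane_diff_ball he hu heu]
      exact setIntegral_congr_fun (measurableSet_truncatedHalfPlane ε) (hcongr ε)
    rw [htrunc]
    have h := tendsto_setIntegral_planeKernel_mul_discSign hp hσ₀ hσ₁ hρ
    rwa [show (n : ℝ) - 2 + 1 = n - 1 by ring] at h

theorem finrank_tangentSpace {ν : EuclideanSpace ℝ (Fin n) → EuclideanSpace ℝ (Fin n)}
    {z : EuclideanSpace ℝ (Fin n)} (hν : ν z ≠ 0) :
    Module.finrank ℝ (tangentSpace ν z) = n - 1 := by
  have h := Submodule.finrank_add_finrank_orthogonal (Submodule.span ℝ {ν z})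
  rw [finrank_span_singleton hν, finrank_euclideanSpace_fin] at h
  change Module.finrank ℝ (Submodule.span ℝ {ν z})ᗮ = n - 1
  omega

end Directional

end NonlocalCurvature

open NonlocalCurvature in
theorem mainTheorem3 (n : ℕ) (hn : 2 ≤ n) (σ : ℝ) (hσ₀ : 0 < σ) (hσ₁ : σ < 1)
    (ρ : ℝ) (hρ : 0 < ρ) (c z : EuclideanSpace ℝ (Fin n)) (hz : z ∈ Metric.sphere c ρ) :
    (∀ e ∈ NonlocalCurvature.tangentSpace (NonlocalCurvature.sphereNormal c ρ) z, ‖e‖ = 1 →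
      NonlocalCurvature.HasNonlocalDirectionalCurvature
          (Metric.sphere c ρ) (NonlocalCurvature.sphereNormal c ρ) σ z e
          (-(ProbabilityTheory.beta ((1 - σ) / 2) (((n : ℝ) - 1) / 2) / (σ * (2 * ρ) ^ σ))) ∧
      NonlocalCurvature.nonlocalDirectionalCurvature
          (Metric.sphere c ρ) (NonlocalCurvature.sphereNormal c ρ) σ z e =
        -(ProbabilityTheory.beta ((1 - σ) / 2) (((n : ℝ) - 1) / 2) / (σ * (2 * ρ) ^ σ))) ∧
    NonlocalCurvature.TensorIntegrable
        (Metric.sphere c ρ) (NonlocalCurvature.sphereNormal c ρ) σ z ∧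
    NonlocalCurvature.nonlocalCurvatureTensor
        (Metric.sphere c ρ) (NonlocalCurvature.sphereNormal c ρ) σ z =
      (-(ProbabilityTheory.beta ((1 - σ) / 2) (((n : ℝ) - 1) / 2) / (σ * (2 * ρ) ^ σ))) •
        ContinuousLinearMap.id ℝ
          (NonlocalCurvature.tangentSpace (NonlocalCurvature.sphereNormal c ρ) z) := by
  set k := -(ProbabilityTheory.beta ((1 - σ) / 2) (((n : ℝ) - 1) / 2) / (σ * (2 * ρ) ^ σ)) with hk
  have hdir : ∀ e ∈ tangentSpace (sphereNormal c ρ) z, ‖e‖ = 1 →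
      HasNonlocalDirectionalCurvature (sphere c ρ) (sphereNormal c ρ) σ z e k :=
    fun e het he => hasNonlocalDirectionalCurvature_sphere hn hσ₀ hσ₁ hρ hz het he
  have hlim : ∀ e ∈ tangentSpace (sphereNormal c ρ) z, ‖e‖ = 1 →
      nonlocalDirectionalCurvature (sphere c ρ) (sphereNormal c ρ) σ z e = k :=
    fun e het he => (hdir e het he).2.limUnder_eq
  have htan : tangentialCurvature (sphere c ρ) (sphereNormal c ρ) σ z = fun _ => k := by
    ext e
    exact hlim _ e.1.2 (norm_eq_of_mem_sphere e)
  refine ⟨fun e het he => ⟨hdir e het he, hlim e het he⟩, ?_, ?_⟩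
  · rw [TensorIntegrable, htan]
    exact sphereIntegrable_const _ _
  · have hν : sphereNormal c ρ z ≠ 0 := by
      rw [← norm_pos_iff, norm_sphereNormal hρ hz]; exact one_pos
    have hn1 : ((n - 1 : ℕ) : ℝ) = n - 1 := by rw [Nat.cast_sub (by omega), Nat.cast_one]
    have hω : omega (n - 1) ≠ 0 := (omega_pos (by omega)).ne'
    have h := finrank_smul_sphereIntegral_const (F := tangentSpace (sphereNormal c ρ) z)
      ((n : ℝ) + σ) k
    rw [finrank_tangentSpace hν, hn1] at h
    rw [nonlocalCurvatureTensor, htan, div_eq_inv_mul, mul_smul, h, smul_smul]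
    congr 1
    have : 1 + σ ≠ 0 := by positivity
    field_simp
    ring
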